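/- **Setting.** Let $A$ be an affine space over a real vector space $L$, with a map $\theta:A\times L\to\mathbb{R}$, linear in the second argument, and a bilinear form $[\cdot,\cdot]:L\times L\to\mathbb{R}$ such that $\theta(\eta+\xi,\tau)=\theta(\eta,\tau)+[\xi,\tau]$. Put $M:=\{\tau\in L:[\xi,\tau]=0\ \forall\xi\in L\}$ and $N:=\{\tau\in L:[\tau,\xi]=0\ \forall\xi\in L\}$. Assume that $\omega(\xi,\xi')=\frac12[\xi,\xi']-\frac12[\xi',\xi]$ is non-degenerate, that $M+N=L$, and that $\theta(\eta,\tau)=0$ for $\eta\in A$, $\tau\in M$. Let $Q:=L/M$ and $C:=A/M$ (an affine space over $Q$), with quotient maps $q:L\to Q$ and $c:A\to C$; then $\theta$ and $[\cdot,\cdot]$ descend to maps $A\times Q\to\mathbb{R}$ and $L\times Q\to\mathbb{R}$. Let $\Omega:Q\times Q\to\mathbb{C}$ be a symmetric real-bilinear form with positive definite real part which is admissible: $Q$ with the inner product $\Re\Omega$ is a separable Hilbert space, $\Im\Omega$ is continuous on it, and the continuous linear functionals on $Q$ are exactly the maps $\phi\mapsto[\xi,\phi]$ with $\xi\in L$.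 Let $\hat Q$ be the algebraic dual of the topological dual of $Q$, which contains $Q$ canonically, with the projective (initial) topology and the $\sigma$-algebra of cylinder sets; let $\nu_Q$ be the Gaussian measure on $\hat Q$, that is, the unique measure whose image on every finite-dimensional quotient $Q/W$ ($W\subseteq Q$ a closed subspace of finite codimension) is the probability measure with density proportional to $\exp(-\|\phi\|^2)$ with respect to Lebesgue measure, where $\|\cdot\|$ is the quotient norm. A function on $Q$ is almost translation invariant (cylindrical) if it is invariant under translations by some closed subspace $W$ of finite codimension; it then extends canonically to $\hat Q$ through the projection $\hat Q\to Q/W$. Let $\mathcal{L}^2(\hat Q,\nu_Q)$ be the space of square-integrable functions $\hat Q\to\mathbb{C}$ (functions, not equivalence classes) with the positive semi-definite inner product $\langle\chi,\psi\rangle=\int_{\hat Q}\psi\,\overline{\chi}\,\mathrm{d}\nu_Q$. For $\zeta\in A$ and $\varphi\in C$ put $$\hat K_\zeta(\varphi):=\exp\Big(\mathrm{i}\,\theta(\zeta,\varphi-c(\zeta))-\tfrac12\Omega(\varphi-c(\zeta),\varphi-c(\zeta))\Big).$$ The $\eta$-reduced wave function of $\Psi:C\to\mathbb{C}$ is the function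 $\Psi^\eta:Q\to\mathbb{C}$ determined by $\Psi(\varphi)=\Psi^{\eta}(\varphi-c(\eta))\,\hat K_\eta(\varphi)$. **Lemma.** Let $\eta,\eta'\in A$, and for $\phi\in Q$ put $\beta_{\eta,\eta'}(\phi):=\hat K_\eta(\phi+c(\eta'))/\hat K_{\eta'}(\phi+c(\eta'))$. 1. For all $\phi\in Q$, $$\beta_{\eta,\eta'}(\phi)=\exp\Big(\mathrm{i}\theta(\eta,\eta'-\eta)-\tfrac12\Omega(q(\eta'-\eta),q(\eta'-\eta))-\mathrm{i}[\eta'-\eta,\phi]-\Omega(q(\eta'-\eta),\phi)\Big),$$ and $\beta_{\eta,\eta'}$ is continuous and almost translation invariant on $Q$. Its canonical extension to $\hat Q$, again denoted $\beta_{\eta,\eta'}$, is well defined (independent of the choice of $W$), and it is the unique continuous function on $\hat Q$ that extends $\beta_{\eta,\eta'}$. 2. For all $\Psi:C\to\mathbb{C}$ and $\phi\in Q$, $\Psi^{\eta'}(\phi)=\Psi^{\eta}(\phi+q(\eta'-\eta))\,\beta_{\eta,\eta'}(\phi)$. If $\Psi^\eta$ is almost translation invariant then so is $\Psi^{\eta'}$,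 and the canonical extensions to $\hat Q$ satisfy the same formula for all $\phi\in\hat Q$. 3. For $\psi\in\mathcal{L}^2(\hat Q,\nu_Q)$, the function $\psi'(\phi):=\psi(\phi+q(\eta'-\eta))\,\beta_{\eta,\eta'}(\phi)$ on $\hat Q$ is an element of $\mathcal{L}^2(\hat Q,\nu_Q)$. The map $\psi\mapsto\psi'$ is an isometric isomorphism of $\mathcal{L}^2(\hat Q,\nu_Q)$: a bijective complex-linear map that preserves the inner product. -/

import Mathlib

open MeasureTheory ProbabilityTheory Complex

universe u

noncomputable section

namespace SchrodingerRep

/-! ### The extension of a real Hilbert space carrying its Gaussian measure -/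

section HilbertExtension

variable (E : Type*) [NormedAddCommGroup E] [InnerProductSpace ℝ E]

/-- The algebraic dual of the topological dual of `E`. -/
def Hat : Type _ := Module.Dual ℝ (StrongDual ℝ E)

instance : AddCommGroup (Hat E) := inferInstanceAs (AddCommGroup (Module.Dual ℝ (StrongDual ℝ E)))

instance : Module ℝ (Hat E) := inferInstanceAs (Module ℝ (Module.Dual ℝ (StrongDual ℝ E)))

variable {E}

/-- The value of a point of `Hat E` on a continuous linear functional. -/
def Hat.eval (Φ : Hat E) : Module.Dual ℝ (StrongDual ℝ E) := Φ

variable (E)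

/-- The projective topology: the coarsest one for which all evaluations at continuous linear
functionals (equivalently, all projections to finite-dimensional quotients) are continuous. -/
instance : TopologicalSpace (Hat E) :=
  TopologicalSpace.induced (fun Φ (l : StrongDual ℝ E) => Φ.eval l) inferInstance

/-- The σ-algebra of cylinder sets: the smallest one for which all evaluations at continuous linear
functionals (equivalently, all projections to finite-dimensional quotients) are measurable. -/
instance : MeasurableSpace (Hat E) :=
  MeasurableSpace.comap (fun Φ (l : StrongDual ℝ E) => Φ.eval l) inferInstance

/-- The canonical inclusion of `E` into the algebraic dual of its topological dual. -/
def incl : E →ₗ[ℝ] Hat E where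
  toFun x := (ContinuousLinearMap.apply ℝ ℝ x : StrongDual ℝ E →L[ℝ] ℝ).toLinearMap
  map_add' x y := by
    refine LinearMap.ext fun l => ?_
    exact map_add l x y
  map_smul' c x := by
    refine LinearMap.ext fun l => ?_
    exact map_smul l c x

/-- The closed subspaces of `E` of finite codimension. They index the finite-dimensional quotients
of `E`. -/
structure FinCodim where
  carrier : Submodule ℝ E
  isClosed : IsClosed (carrier : Set E)
  finiteDimensional : FiniteDimensional ℝ (E ⧸ carrier)

variable {E}

/-- The finite-dimensional quotient space belonging to a closed subspace of finite codimension. -/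
abbrev FinCodim.Quot (W : FinCodim E) : Type _ := E ⧸ W.carrier

instance (W : FinCodim E) : IsClosed (W.carrier : Set E) := W.isClosed

instance (W : FinCodim E) : FiniteDimensional ℝ W.Quot := W.finiteDimensional

instance (W : FinCodim E) : MeasurableSpace W.Quot := borel _

instance (W : FinCodim E) : BorelSpace W.Quot := ⟨rfl⟩

instance (W : FinCodim E) [CompleteSpace E] : CompleteSpace W.carrier :=
  W.isClosed.completeSpace_coe

/-- The pullback to `E` of a linear functional on a finite-dimensional quotient `E ⧸ W`. -/
def pullback (W : FinCodim E) : Module.Dual ℝ W.Quot →ₗ[ℝ] StrongDual ℝ E where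
  toFun l := (LinearMap.toContinuousLinearMap l).comp W.carrier.mkQL
  map_add' l l' := by ext x; rfl
  map_smul' c l := by ext x; rfl

/-- The canonical projection of `Hat E` onto a finite-dimensional quotient `E ⧸ W`: a point `Φ`
induces the functional `l ↦ Φ (l ∘ mk)` on the dual of `E ⧸ W`, that is, a point of the bidual
of `E ⧸ W`, which is `E ⧸ W` itself. -/
def proj (W : FinCodim E) : Hat E →ₗ[ℝ] W.Quot :=
  (Module.evalEquiv ℝ W.Quot).symm.toLinearMap ∘ₗ (pullback W).dualMap

theorem apply_proj (W : FinCodim E) (Φ : Hat E) (l : Module.Dual ℝ W.Quot) :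
    l (proj W Φ) = Φ.eval (pullback W l) :=
  Module.apply_evalEquiv_symm_apply ℝ W.Quot l ((pullback W).dualMap Φ)

/-- The centred Gaussian probability measure on a finite-dimensional Euclidean space `V` with
density proportional to `exp (-‖x‖ ^ 2)` with respect to the Lebesgue measure. -/
def gaussian (V : Type*) [NormedAddCommGroup V] [InnerProductSpace ℝ V] [FiniteDimensional ℝ V]
    [MeasurableSpace V] [BorelSpace V] : Measure V :=
  (∫⁻ x : V, ENNReal.ofReal (Real.exp (-‖x‖ ^ 2)))⁻¹ •
    (volume : Measure V).withDensity (fun x => ENNReal.ofReal (Real.exp (-‖x‖ ^ 2)))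

/-- `ν` is the projective limit of the Gaussian measures on the finite-dimensional quotients
of `E`. -/
def IsProjectiveGaussian [CompleteSpace E] (ν : Measure (Hat E)) : Prop :=
  ∀ W : FinCodim E, ν.map (proj W) = gaussian W.Quot

/-- A function on `E` descends to `E ⧸ W` if it is invariant under translations by `W`. -/
def DescendsTo (W : FinCodim E) (f : E → ℂ) : Prop :=
  ∀ x : E, ∀ w ∈ W.carrier, f (x + w) = f x

/-- A function on `E` is cylindrical, or almost translation invariant, if it is invariant under
translations by a closed subspace of finite codimension. -/
def IsCylindrical (f : E → ℂ) : Prop := ∃ W : FinCodim E, DescendsTo W f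

open Classical in
/-- The canonical extension of a cylindrical function `f` to `Hat E`: if `f` is induced from a
function on `E ⧸ W`, its extension is that function composed with `Hat E → E ⧸ W`. -/
def cylExtend (f : E → ℂ) (Φ : Hat E) : ℂ :=
  if h : IsCylindrical f then f (Quotient.out (proj h.choose Φ)) else 0

end HilbertExtension

section Existence

variable {E : Type*} [NormedAddCommGroup E] [InnerProductSpace ℝ E]

theorem measurable_eval (l : StrongDual ℝ E) : Measurable fun Φ : Hat E => Φ.eval l :=
  (measurable_pi_apply l).comp (comap_measurable (fun (Φ : Hat E) (l : StrongDual ℝ E) => Φ.eval l))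

theorem measurable_hat {S : Type*} [MeasurableSpace S] {f : S → Hat E}
    (h : ∀ l, Measurable fun s => (f s).eval l) : Measurable f := by
  rw [measurable_comap_iff]
  exact measurable_pi_iff.2 h

theorem measurable_proj (W : FinCodim E) : Measurable (proj W) := by
  let b := Module.finBasis ℝ W.Quot
  have h : (proj W : Hat E → W.Quot) = fun Φ => ∑ i, Φ.eval (pullback W (b.coord i)) • b i := by
    funext Φ
    conv_lhs => rw [← b.sum_repr (proj W Φ)]
    refine Finset.sum_congr rfl fun i _ => ?_
    rw [← apply_proj]
    rfl
  rw [h]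
  exact Finset.measurable_sum _ fun i _ => (measurable_eval _).smul_const _

section Gaussian

variable (V : Type*) [NormedAddCommGroup V] [InnerProductSpace ℝ V] [FiniteDimensional ℝ V]
    [MeasurableSpace V] [BorelSpace V]

theorem integrable_rexp_neg_sq : Integrable fun x : V => Real.exp (-‖x‖ ^ 2) := by
  have h := GaussianFourier.integrable_cexp_neg_mul_sq_norm_add (V := V) (b := 1) (by simp) 0 0
  have h2 := h.norm
  refine h2.congr (Filter.Eventually.of_forall fun x => ?_)
  simp only [Complex.norm_exp]
  congr 1
  simp [← Complex.ofReal_pow]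

theorem lintegral_gaussian_density :
    ∫⁻ x : V, ENNReal.ofReal (Real.exp (-‖x‖ ^ 2)) =
      ENNReal.ofReal (Real.pi ^ (Module.finrank ℝ V / 2 : ℝ)) := by
  rw [← ofReal_integral_eq_lintegral_ofReal (integrable_rexp_neg_sq V)
    (Filter.Eventually.of_forall fun x => (Real.exp_pos _).le)]
  have := GaussianFourier.integral_rexp_neg_mul_sq_norm (V := V) (b := 1) one_pos
  simp only [neg_mul, one_mul, div_one] at this
  rw [this]

instance isProbabilityMeasure_gaussian : IsProbabilityMeasure (gaussian V) := by
  constructor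
  rw [gaussian, Measure.smul_apply, withDensity_apply _ MeasurableSet.univ, Measure.restrict_univ,
    smul_eq_mul]
  refine ENNReal.inv_mul_cancel ?_ ?_
  · rw [lintegral_gaussian_density]
    simpa using Real.rpow_pos_of_pos Real.pi_pos _
  · rw [lintegral_gaussian_density]
    exact ENNReal.ofReal_ne_top

theorem charFun_gaussian (t : V) : charFun (gaussian V) t = cexp (-(‖t‖ ^ 2 / 4 : ℝ)) := by
  have hm : Measurable fun x : V => ENNReal.ofReal (Real.exp (-‖x‖ ^ 2)) := by fun_prop
  rw [charFun_apply, gaussian, integral_smul_measure, lintegral_gaussian_density,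
    integral_withDensity_eq_integral_toReal_smul hm
      (Filter.Eventually.of_forall fun x => ENNReal.ofReal_lt_top)]
  have h := GaussianFourier.integral_cexp_neg_mul_sq_norm_add (V := V) (b := 1) (by simp) I t
  have h2 : (∫ x : V, (ENNReal.ofReal (Real.exp (-‖x‖ ^ 2))).toReal •
      cexp ((inner ℝ x t : ℝ) * I)) = ∫ v : V, cexp (-1 * (‖v‖ : ℂ) ^ 2 + I * (inner ℝ t v : ℝ)) := by
    refine integral_congr_ae (Filter.Eventually.of_forall fun x => ?_)
    simp only
    rw [ENNReal.toReal_ofReal (Real.exp_pos _).le, Complex.real_smul, Complex.ofReal_exp,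
      ← Complex.exp_add, real_inner_comm]
    congr 1
    push_cast
    ring
  rw [h2, h]
  have hp : (0 : ℝ) < Real.pi ^ (Module.finrank ℝ V / 2 : ℝ) := Real.rpow_pos_of_pos Real.pi_pos _
  rw [ENNReal.toReal_inv, ENNReal.toReal_ofReal hp.le, Complex.real_smul, div_one]
  have hc : (Real.pi : ℂ) ^ (Module.finrank ℝ V / 2 : ℂ) =
      ((Real.pi ^ (Module.finrank ℝ V / 2 : ℝ) : ℝ) : ℂ) := by
    rw [Complex.ofReal_cpow Real.pi_pos.le]
    push_cast
    rfl
  rw [hc, ← mul_assoc, ← Complex.ofReal_mul, inv_mul_cancel₀ hp.ne', Complex.ofReal_one, one_mul]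
  congr 1
  push_cast
  rw [Complex.I_sq]
  ring

end Gaussian

/-- The functional on `E` induced by `⟪·, t⟫` on a quotient has norm `‖t‖`. -/
theorem norm_pullback_inner [CompleteSpace E] (W : FinCodim E) (t : W.Quot) :
    ‖pullback W (innerₛₗ ℝ t)‖ = ‖t‖ := by
  refine le_antisymm (ContinuousLinearMap.opNorm_le_bound _ (norm_nonneg _) fun x => ?_) ?_
  · calc ‖inner ℝ t (W.carrier.mkQ x)‖ ≤ ‖t‖ * ‖W.carrier.mkQ x‖ := norm_inner_le_norm _ _
      _ ≤ ‖t‖ * ‖x‖ := by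
        gcongr
        exact Submodule.Quotient.norm_mk_le W.carrier x
  · rcases eq_or_ne t 0 with rfl | ht
    · simp
    let e := W.carrier.quotientEquivOrthogonal
    have h1 : W.carrier.mkQ ((e t : W.carrierᗮ) : E) = t := by
      have := W.carrier.quotientEquivOrthogonal_symm_eq_mk (e t : E) (e t).2
      rw [Submodule.mkQ_apply, ← this]
      exact e.symm_apply_apply t
    have h2 : ‖((e t : W.carrierᗮ) : E)‖ = ‖t‖ := by
      exact e.norm_map t
    have h3 := (pullback W (innerₛₗ ℝ t)).le_opNorm ((e t : W.carrierᗮ) : E)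
    have h4 : pullback W (innerₛₗ ℝ t) ((e t : W.carrierᗮ) : E) = ‖t‖ ^ 2 := by
      change inner ℝ t (W.carrier.mkQ ((e t : W.carrierᗮ) : E)) = _
      rw [h1, real_inner_self_eq_norm_sq]
    rw [h4, h2] at h3
    have h5 : 0 < ‖t‖ := norm_pos_iff.2 ht
    have h6 : ‖t‖ ^ 2 ≤ ‖pullback W (innerₛₗ ℝ t)‖ * ‖t‖ := by
      simpa using h3
    nlinarith

theorem isProjectiveGaussian_of_charFun [CompleteSpace E] (ν : Measure (Hat E)) [IsFiniteMeasure ν]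
    (h : ∀ l : StrongDual ℝ E, ∫ Φ, cexp ((Φ.eval l : ℝ) * I) ∂ν = cexp (-(‖l‖ ^ 2 / 4 : ℝ))) :
    IsProjectiveGaussian ν := by
  intro W
  have : IsFiniteMeasure (ν.map (proj W)) := Measure.isFiniteMeasure_map _ _
  refine Measure.ext_of_charFun ?_
  funext t
  rw [charFun_gaussian, charFun_apply, integral_map (measurable_proj W).aemeasurable
    (by fun_prop)]
  rw [← norm_pullback_inner W t, ← h]
  refine integral_congr_ae (Filter.Eventually.of_forall fun Φ => ?_)
  simp only
  rw [← apply_proj, real_inner_comm]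
  rfl

theorem continuous_charFun_lp {S : Type*} [MeasurableSpace S] (P : Measure S)
    [IsProbabilityMeasure P] :
    Continuous fun U : Lp ℝ 2 P => ∫ s, cexp ((U s : ℝ) * I) ∂P := by
  have key : ∀ U : Lp ℝ 2 P, Integrable (fun s => cexp ((U s : ℝ) * I)) P := fun U => by
    refine Integrable.of_bound (C := 1) ?_ (Filter.Eventually.of_forall fun s => ?_)
    · have := (Lp.aestronglyMeasurable U).aemeasurable
      exact (by fun_prop : AEMeasurable (fun s => cexp ((U s : ℝ) * I)) P).aestronglyMeasurable
    · rw [Complex.norm_exp_ofReal_mul_I]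
  refine LipschitzWith.continuous (K := 1) (LipschitzWith.of_dist_le_mul fun U V => ?_)
  rw [NNReal.coe_one, one_mul, dist_eq_norm, dist_eq_norm, ← integral_sub (key U) (key V)]
  have hW : MemLp (fun s => (U - V) s) 2 P := Lp.memLp (U - V)
  calc ‖∫ s, (cexp ((U s : ℝ) * I) - cexp ((V s : ℝ) * I)) ∂P‖
      ≤ ∫ s, ‖cexp ((U s : ℝ) * I) - cexp ((V s : ℝ) * I)‖ ∂P := norm_integral_le_integral_norm _
    _ ≤ ∫ s, ‖(U - V) s‖ ∂P := by
      refine integral_mono_ae ((key U).sub (key V)).norm (hW.integrable one_le_two).norm ?_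
      filter_upwards [Lp.coeFn_sub U V] with s hs
      rw [hs, Pi.sub_apply]
      have h1 : cexp ((U s : ℝ) * I) - cexp ((V s : ℝ) * I) =
          cexp ((V s : ℝ) * I) * (cexp (I * ((U s - V s : ℝ) : ℂ)) - 1) := by
        rw [mul_sub, mul_one, ← Complex.exp_add]
        congr 2
        push_cast
        ring
      rw [h1, norm_mul, Complex.norm_exp_ofReal_mul_I, one_mul]
      exact Real.norm_exp_I_mul_ofReal_sub_one_le
    _ ≤ ‖U - V‖ := by
      rw [integral_norm_eq_lintegral_enorm hW.1, Lp.norm_def, ← eLpNorm_one_eq_lintegral_enorm]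
      exact ENNReal.toReal_mono (Lp.eLpNorm_ne_top _)
        (eLpNorm_le_eLpNorm_of_exponent_le one_le_two hW.1)

section White

variable {w : Type*}

theorem memLp_coord (i : w) :
    MemLp (fun s : w → ℝ => s i) 2 (Measure.infinitePi fun _ : w => gaussianReal 0 1) :=
  MemLp.comp_measurePreserving (g := id) (memLp_id_gaussianReal' 2 (by simp))
    (measurePreserving_eval_infinitePi (fun _ : w => gaussianReal 0 1) i)

/-- The coordinates of white noise as square-integrable random variables. -/
def coordLp (i : w) : Lp ℝ 2 (Measure.infinitePi fun _ : w => gaussianReal 0 1) :=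
  (memLp_coord i).toLp

theorem coeFn_coordLp (i : w) : coordLp i
    =ᵐ[Measure.infinitePi fun _ : w => gaussianReal 0 1] fun s => s i :=
  (memLp_coord i).coeFn_toLp

theorem orthonormal_coord : Orthonormal ℝ (coordLp (w := w)) := by
  classical
  have hind : iIndepFun (fun (i : w) (s : w → ℝ) => s i)
      (Measure.infinitePi fun _ : w => gaussianReal 0 1) :=
    iIndepFun_infinitePi (X := fun _ x => x) (by fun_prop)
  have hmean : ∀ i : w, ∫ s, s i ∂(Measure.infinitePi fun _ : w => gaussianReal 0 1) = 0 := by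
    intro i
    have h := (measurePreserving_eval_infinitePi (fun _ : w => gaussianReal 0 1) i)
    rw [← integral_map (f := fun x : ℝ => x) (φ := fun s : w → ℝ => s i)
      (measurable_pi_apply i).aemeasurable (by fun_prop)]
    have h2 := h.map_eq
    change Measure.map (fun s : w → ℝ => s i) _ = _ at h2
    rw [h2, integral_id_gaussianReal]
  have hvar : ∀ i : w, ∫ s, s i * s i ∂(Measure.infinitePi fun _ : w => gaussianReal 0 1) = 1 := by
    intro i
    have h := (measurePreserving_eval_infinitePi (fun _ : w => gaussianReal 0 1) i)
    rw [← integral_map (f := fun x : ℝ => x * x) (φ := fun s : w → ℝ => s i)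
      (measurable_pi_apply i).aemeasurable (by fun_prop)]
    have h2 := h.map_eq
    change Measure.map (fun s : w → ℝ => s i) _ = _ at h2
    rw [h2]
    have h3 : Var[fun x : ℝ => x; gaussianReal 0 1] = 1 := by simp [variance_fun_id_gaussianReal]
    rw [variance_of_integral_eq_zero (by fun_prop) (by simp [integral_id_gaussianReal])] at h3
    simpa [pow_two] using h3
  rw [orthonormal_iff_ite]
  intro i j
  rw [L2.inner_def]
  have h : ∫ s, inner ℝ (coordLp i s) (coordLp j s)
      ∂(Measure.infinitePi fun _ : w => gaussianReal 0 1) =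
      ∫ s : w → ℝ, s i * s j ∂(Measure.infinitePi fun _ : w => gaussianReal 0 1) := by
    refine integral_congr_ae ?_
    filter_upwards [coeFn_coordLp i, coeFn_coordLp j] with s h1 h2
    rw [h1, h2]
    simp [mul_comm]
  rw [h]
  split_ifs with hij
  · subst hij; exact hvar i
  · rw [(hind.indepFun hij).integral_fun_mul_eq_mul_integral
      (measurable_pi_apply i).aestronglyMeasurable (measurable_pi_apply j).aestronglyMeasurable, hmean,
      zero_mul]

theorem charFun_finite_sum (s : Finset w) (a : w → ℝ) :
    ∫ ω : w → ℝ, cexp (((∑ i ∈ s, a i * ω i : ℝ) : ℂ) * I)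
      ∂(Measure.infinitePi fun _ : w => gaussianReal 0 1) =
      cexp (-((∑ i ∈ s, a i ^ 2) / 2 : ℝ)) := by
  have hind : iIndepFun (fun (i : w) (ω : w → ℝ) => a i * ω i)
      (Measure.infinitePi fun _ : w => gaussianReal 0 1) :=
    iIndepFun_infinitePi (X := fun i x => a i * x) (by fun_prop)
  have hm : ∀ i : w, Measurable fun ω : w → ℝ => a i * ω i := fun i =>
    (measurable_const_mul (a i)).comp (measurable_pi_apply i)
  have h := iIndepFun.charFun_map_fun_finsetSum_eq_prod (s := s)
    (fun i _ => (hm i).aemeasurable) (hind.restrict s)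
  have h1 := congrFun h 1
  rw [charFun_apply, integral_map (Finset.measurable_sum _ fun i _ => hm i).aemeasurable
    (by fun_prop)] at h1
  simp only [RCLike.inner_apply, conj_trivial, one_mul, Finset.prod_apply] at h1
  rw [h1]
  have h2 : ∀ i ∈ s, charFun (Measure.map (fun ω : w → ℝ => a i * ω i)
      (Measure.infinitePi fun _ : w => gaussianReal 0 1)) 1 = cexp (-(a i ^ 2 / 2 : ℝ)) := by
    intro i _
    have h3 : Measure.map (fun ω : w → ℝ => a i * ω i)
        (Measure.infinitePi fun _ : w => gaussianReal 0 1) = (gaussianReal 0 1).map (a i * ·) := by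
      have h4 := (measurePreserving_eval_infinitePi (fun _ : w => gaussianReal 0 1) i).map_eq
      change Measure.map (fun s : w → ℝ => s i) _ = _ at h4
      conv_rhs => rw [← h4]
      exact (Measure.map_map (measurable_const_mul (a i)) (measurable_pi_apply i)).symm
    rw [h3, gaussianReal_map_const_mul, charFun_gaussianReal]
    congr 1
    simp
    try ring
  rw [Finset.prod_congr rfl h2, ← Complex.exp_sum]
  congr 1
  push_cast
  rw [Finset.sum_neg_distrib, Finset.sum_div]

end White

theorem coeFn_finsetSum {S ι : Type*} [MeasurableSpace S] {P : Measure S} (s : Finset ι)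
    (f : ι → Lp ℝ 2 P) : ((∑ i ∈ s, f i : Lp ℝ 2 P) : S → ℝ) =ᵐ[P] ∑ i ∈ s, (f i : S → ℝ) := by
  classical
  induction s using Finset.induction_on with
  | empty => simpa using Lp.coeFn_zero ℝ 2 P
  | insert i s hi ih =>
    rw [Finset.sum_insert hi, Finset.sum_insert hi]
    exact (Lp.coeFn_add _ _).trans (Filter.EventuallyEq.rfl.add ih)

theorem exists_isonormal (E : Type u) [NormedAddCommGroup E] [InnerProductSpace ℝ E]
    [CompleteSpace E] :
    ∃ (S : Type u) (_ : MeasurableSpace S) (P : Measure S) (_ : IsProbabilityMeasure P)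
      (T : E →ₗᵢ[ℝ] Lp ℝ 2 P),
      ∀ x : E, ∫ s, cexp ((T x s : ℝ) * I) ∂P = cexp (-(‖x‖ ^ 2 / 2 : ℝ)) := by
  classical
  obtain ⟨w, b, -⟩ := exists_hilbertBasis ℝ E
  let P : Measure (w → ℝ) := Measure.infinitePi fun _ : w => gaussianReal 0 1
  let T : E →ₗᵢ[ℝ] Lp ℝ 2 P :=
    (orthonormal_coord (w := w)).orthogonalFamily.linearIsometry.comp b.repr.toLinearIsometry
  have hT : ∀ i, T (b i) = coordLp i := by
    intro i
    change (orthonormal_coord (w := w)).orthogonalFamily.linearIsometry (b.repr (b i)) = _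
    rw [HilbertBasis.repr_self, OrthogonalFamily.linearIsometry_apply_single]
    simp
  refine ⟨w → ℝ, inferInstance, P, inferInstance, T, fun x => ?_⟩
  have hsum := b.hasSum_repr x
  have h1 : Filter.Tendsto (fun s : Finset w =>
      ∫ ω, cexp ((T (∑ i ∈ s, b.repr x i • b i) ω : ℝ) * I) ∂P) Filter.atTop
      (nhds (∫ ω, cexp ((T x ω : ℝ) * I) ∂P)) :=
    (((continuous_charFun_lp P).comp T.continuous).tendsto x).comp hsum
  have h2 : Filter.Tendsto (fun s : Finset w =>
      cexp (-(‖∑ i ∈ s, b.repr x i • b i‖ ^ 2 / 2 : ℝ))) Filter.atTop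
      (nhds (cexp (-(‖x‖ ^ 2 / 2 : ℝ)))) :=
    ((by fun_prop : Continuous fun y : E => cexp (-(‖y‖ ^ 2 / 2 : ℝ))).tendsto x).comp hsum
  refine tendsto_nhds_unique h1 (h2.congr fun s => ?_)
  have hn : ‖∑ i ∈ s, b.repr x i • b i‖ ^ 2 = ∑ i ∈ s, (b.repr x i) ^ 2 := by
    rw [← real_inner_self_eq_norm_sq, b.orthonormal.inner_sum]
    simp [pow_two]
  rw [hn, ← charFun_finite_sum]
  refine integral_congr_ae ?_
  have hae : ∀ᵐ ω ∂P, ∀ i ∈ s, (coordLp i : Lp ℝ 2 P) ω = ω i := by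
    rw [Finset.eventually_all]
    exact fun i _ => coeFn_coordLp i
  have hsm : T (∑ i ∈ s, b.repr x i • b i) =
      ∑ i ∈ s, b.repr x i • coordLp i := by
    rw [map_sum]
    exact Finset.sum_congr rfl fun i _ => by rw [map_smul, hT]
  rw [hsm]
  have hae2 : ∀ᵐ ω ∂P, ∀ i ∈ s, (b.repr x i • coordLp i : Lp ℝ 2 P) ω =
      b.repr x i • (coordLp i : Lp ℝ 2 P) ω := by
    rw [Finset.eventually_all]
    exact fun i _ => Lp.coeFn_smul _ _
  filter_upwards [hae, hae2, coeFn_finsetSum s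
    (fun i => (b.repr x i • coordLp i : Lp ℝ 2 P))] with ω ha hb hc
  rw [hc, Finset.sum_apply]
  congr 3
  refine Finset.sum_congr rfl fun i hi => ?_
  rw [hb i hi, ha i hi, smul_eq_mul]

theorem exists_gaussian (E : Type*) [NormedAddCommGroup E] [InnerProductSpace ℝ E]
    [CompleteSpace E] : ∃ ν : Measure (Hat E), IsProbabilityMeasure ν ∧
      ∀ l : StrongDual ℝ E, ∫ Φ, cexp ((Φ.eval l : ℝ) * I) ∂ν = cexp (-(‖l‖ ^ 2 / 4 : ℝ)) := by
  obtain ⟨S, _, P, _, T, hT⟩ := exists_isonormal E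
  let G : StrongDual ℝ E →ₗ[ℝ] Lp ℝ 2 P :=
    T.toLinearMap ∘ₗ ((√2 : ℝ)⁻¹ • (InnerProductSpace.toDual ℝ E).symm.toLinearEquiv.toLinearMap)
  let b := Module.Basis.ofVectorSpace ℝ (StrongDual ℝ E)
  let Φ : S → Hat E := fun s => b.constr ℝ fun i => G (b i) s
  have heval : ∀ l s, (Φ s).eval l = ∑ i ∈ (b.repr l).support, b.repr l i * G (b i) s := by
    intro l s
    change b.constr ℝ (fun i => G (b i) s) l = _
    rw [Module.Basis.constr_apply]
    rfl
  have hmeas : Measurable Φ := measurable_hat fun l => by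
    simp_rw [heval l]
    exact Finset.measurable_sum _ fun i _ =>
      (Lp.stronglyMeasurable (G (b i))).measurable.const_mul _
  refine ⟨P.map Φ, Measure.isProbabilityMeasure_map hmeas.aemeasurable, fun l => ?_⟩
  have hm : AEStronglyMeasurable (fun Ψ : Hat E => cexp ((Ψ.eval l : ℝ) * I)) (P.map Φ) := by
    have := measurable_eval l
    exact (by fun_prop : Measurable fun Ψ : Hat E => cexp ((Ψ.eval l : ℝ) * I)).aestronglyMeasurable
  rw [integral_map hmeas.aemeasurable hm]
  have hx := hT ((√2 : ℝ)⁻¹ • (InnerProductSpace.toDual ℝ E).symm l)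
  have hn : ‖(√2 : ℝ)⁻¹ • (InnerProductSpace.toDual ℝ E).symm l‖ ^ 2 / 2 = ‖l‖ ^ 2 / 4 := by
    rw [norm_smul, LinearIsometryEquiv.norm_map, mul_pow, norm_inv, inv_pow, Real.norm_eq_abs,
      sq_abs, Real.sq_sqrt zero_le_two]
    ring
  rw [← hn, ← hx]
  refine integral_congr_ae ?_
  have hG : G l = ∑ i ∈ (b.repr l).support, b.repr l i • G (b i) := by
    conv_lhs => rw [← b.linearCombination_repr l, Finsupp.linearCombination_apply, Finsupp.sum,
      map_sum]
    exact Finset.sum_congr rfl fun i _ => map_smul _ _ _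
  have hae : ∀ᵐ s ∂P, ∀ i ∈ (b.repr l).support, (b.repr l i • G (b i) : Lp ℝ 2 P) s =
      b.repr l i • (G (b i) : Lp ℝ 2 P) s := by
    rw [Finset.eventually_all]
    exact fun i _ => Lp.coeFn_smul _ _
  filter_upwards [hae, coeFn_finsetSum (b.repr l).support
    (fun i => (b.repr l i • G (b i) : Lp ℝ 2 P))] with s ha hc
  have h1 : (T ((√2 : ℝ)⁻¹ • (InnerProductSpace.toDual ℝ E).symm l) : Lp ℝ 2 P) = G l := rfl
  rw [heval, h1, hG, hc, Finset.sum_apply]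
  congr 3
  exact Finset.sum_congr rfl fun i hi => by rw [ha i hi, smul_eq_mul]

/-- The common kernel of finitely many continuous linear functionals. -/
def commonKer (I : Finset (StrongDual ℝ E)) : FinCodim E where
  carrier := (ContinuousLinearMap.pi fun l : I => (l : StrongDual ℝ E)).ker
  isClosed := ContinuousLinearMap.isClosed_ker _
  finiteDimensional :=
    (LinearMap.quotKerEquivRange
      (ContinuousLinearMap.pi fun l : I => (l : StrongDual ℝ E)).toLinearMap).symm.finiteDimensional

theorem exists_pullback_eq (I : Finset (StrongDual ℝ E)) (l : I) :
    ∃ l' : Module.Dual ℝ (commonKer I).Quot, pullback (commonKer I) l' = l := by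
  refine ⟨(commonKer I).carrier.liftQ (l : StrongDual ℝ E).toLinearMap fun x hx => ?_, ?_⟩
  · exact congrFun (LinearMap.mem_ker.1 hx) l
  · ext x
    rfl

theorem isProbabilityMeasure_of_isProjectiveGaussian [CompleteSpace E] {ν : Measure (Hat E)}
    (h : IsProjectiveGaussian ν) : IsProbabilityMeasure ν := by
  have h1 : IsProbabilityMeasure (ν.map (proj (commonKer (∅ : Finset (StrongDual ℝ E))))) := by
    rw [h]
    infer_instance
  exact (Measure.isProbabilityMeasure_map_iff (measurable_proj _).aemeasurable).1 h1

theorem isProjectiveGaussian_unique [CompleteSpace E] {ν ν' : Measure (Hat E)}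
    (h : IsProjectiveGaussian ν) (h' : IsProjectiveGaussian ν') : ν = ν' := by
  have := isProbabilityMeasure_of_isProjectiveGaussian h
  have := isProbabilityMeasure_of_isProjectiveGaussian h'
  let e : Hat E → StrongDual ℝ E → ℝ := fun Φ l => Φ.eval l
  have he : Measurable e := comap_measurable _
  have key : ν.map e = ν'.map e := by
    have : ∀ I : Finset (StrongDual ℝ E), IsFiniteMeasure ((ν'.map e).map I.restrict) :=
      fun I => inferInstance
    refine IsProjectiveLimit.unique (P := fun I => (ν'.map e).map I.restrict) (fun I => ?_)
      (fun I => rfl)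
    choose g hg using exists_pullback_eq I
    have hf : I.restrict ∘ e = (fun x l => g l x) ∘ proj (commonKer I) := by
      funext Φ l
      change Φ.eval l = g l (proj (commonKer I) Φ)
      rw [apply_proj, hg]
    have hgm : Measurable fun (x : (commonKer I).Quot) (l : I) => g l x :=
      measurable_pi_iff.2 fun l => (LinearMap.continuous_of_finiteDimensional (g l)).measurable
    change (ν.map e).map I.restrict = (ν'.map e).map I.restrict
    rw [Measure.map_map (by fun_prop) he, Measure.map_map (by fun_prop) he, hf,
      ← Measure.map_map hgm (measurable_proj _), ← Measure.map_map hgm (measurable_proj _), h, h']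
  refine Measure.ext fun s hs => ?_
  obtain ⟨t, ht, rfl⟩ := hs
  change ν (e ⁻¹' t) = ν' (e ⁻¹' t)
  rw [← Measure.map_apply he ht, key, Measure.map_apply he ht]

theorem existsUnique_projectiveGaussian (E : Type*) [NormedAddCommGroup E] [InnerProductSpace ℝ E]
    [CompleteSpace E] : ∃! ν : Measure (Hat E), IsProjectiveGaussian ν := by
  obtain ⟨ν, _, hν⟩ := exists_gaussian E
  exact ⟨ν, isProjectiveGaussian_of_charFun ν hν,
    fun ν' h => isProjectiveGaussian_unique h (isProjectiveGaussian_of_charFun ν hν)⟩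

end Existence

/-- The Gaussian measure on the extension `Hat E` of a real Hilbert space `E`: the unique measure
which projects to the Gaussian measures on all finite-dimensional quotients of `E`. -/
def gaussianHat (E : Type*) [NormedAddCommGroup E] [InnerProductSpace ℝ E] [CompleteSpace E] :
    Measure (Hat E) :=
  (existsUnique_projectiveGaussian E).choose

/-- The space of square-integrable functions (not equivalence classes) on `Hat E`. -/
def SqInt (E : Type*) [NormedAddCommGroup E] [InnerProductSpace ℝ E] [CompleteSpace E] :
    Submodule ℂ (Hat E → ℂ) where
  carrier := {ψ | MemLp ψ 2 (gaussianHat E)}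
  zero_mem' := MemLp.zero
  add_mem' := fun h h' => MemLp.add h h'
  smul_mem' := fun c _ h => MemLp.const_smul h c

/-- The positive semi-definite inner product of square-integrable functions. -/
def innerProd {E : Type*} [NormedAddCommGroup E] [InnerProductSpace ℝ E] [CompleteSpace E]
    (χ ψ : Hat E → ℂ) : ℂ :=
  ∫ Φ, ψ Φ * starRingEnd ℂ (χ Φ) ∂(gaussianHat E)

/-! ### Affine field theory -/

/-- The quotient of an affine space `A` over `L` by a linear subspace `M` of `L`. -/
def quotSetoid {L : Type*} [AddCommGroup L] [Module ℝ L] (M : Submodule ℝ L) (A : Type*)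
    [AddTorsor L A] : Setoid A where
  r a b := a -ᵥ b ∈ M
  iseqv :=
    { refl := fun a => by simp
      symm := fun {a b} h => by
        rw [← neg_vsub_eq_vsub_rev]; exact M.neg_mem h
      trans := fun {a b c} h h' => by
        rw [← vsub_add_vsub_cancel a b c]; exact M.add_mem h h' }

/-- The classical data: an affine space `A` of solutions over the real vector space `L`, a
symplectic potential `θ` which is equivariant through a bilinear form `bracket` on `L`. -/
structure PotentialData (A L : Type*) [AddCommGroup L] [Module ℝ L] [AddTorsor L A] where
  θ : A → L →ₗ[ℝ] ℝ
  bracket : L →ₗ[ℝ] L →ₗ[ℝ] ℝ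
  equivariant : ∀ (η : A) (ξ τ : L), θ (ξ +ᵥ η) τ = θ η τ + bracket ξ τ

namespace PotentialData

variable {A L : Type*} [AddCommGroup L] [Module ℝ L] [AddTorsor L A] (F : PotentialData A L)

/-- The symplectic form. -/
def ω (ξ ξ' : L) : ℝ := 1 / 2 * F.bracket ξ ξ' - 1 / 2 * F.bracket ξ' ξ

/-- The subspace `M` of momentum directions. -/
def M : Submodule ℝ L where
  carrier := {τ | ∀ ξ, F.bracket ξ τ = 0}
  zero_mem' := by simp
  add_mem' := by intro a b ha hb ξ; simp [ha ξ, hb ξ]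
  smul_mem' := by intro c a ha ξ; simp [ha ξ]

/-- The complementary subspace `N`. -/
def N : Submodule ℝ L where
  carrier := {τ | ∀ ξ, F.bracket τ ξ = 0}
  zero_mem' := by simp
  add_mem' := by intro a b ha hb ξ; simp [ha ξ, hb ξ]
  smul_mem' := by intro c a ha ξ; simp [ha ξ]

end PotentialData

/-- An affine field theory: the symplectic form is non-degenerate, `M` and `N` generate `L`, and
the symplectic potential is adapted to the Schrödinger polarization defined by `M`. -/
structure AffineFieldTheory (A L : Type*) [AddCommGroup L] [Module ℝ L] [AddTorsor L A] extends
    PotentialData A L where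
  nondegenerate : ∀ ξ : L, (∀ ξ' : L, toPotentialData.ω ξ ξ' = 0) → ξ = 0
  generate : toPotentialData.M ⊔ toPotentialData.N = ⊤
  adapted : ∀ (η : A), ∀ τ ∈ toPotentialData.M, θ η τ = 0

/-- An affine field theory with a symmetric real-bilinear form `Ω : Q × Q → ℂ` on the space
`Q = L ⧸ M`, with positive definite real part. -/
structure SchrodingerData (A L : Type*) [AddCommGroup L] [Module ℝ L] [AddTorsor L A] extends
    AffineFieldTheory A L where
  Ω : (L ⧸ toAffineFieldTheory.M) →ₗ[ℝ] (L ⧸ toAffineFieldTheory.M) →ₗ[ℝ] ℂ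
  symm : ∀ φ φ', Ω φ φ' = Ω φ' φ
  pos : ∀ φ, φ ≠ 0 → 0 < (Ω φ φ).re

namespace SchrodingerData

variable {A L : Type*} [AddCommGroup L] [Module ℝ L] [AddTorsor L A] (D : SchrodingerData A L)

/-- The space `Q = L ⧸ M`. -/
def Q : Type _ := L ⧸ D.M

/-- The affine space `C = A ⧸ M` of field configurations. -/
def C : Type _ := Quotient (quotSetoid D.M A)

/-- The real part of `Ω` as an inner product on `Q`. -/
@[reducible]
def core : InnerProductSpace.Core ℝ (L ⧸ D.M) where
  inner φ φ' := (D.Ω φ φ').re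
  conj_inner_symm φ φ' := by simp [D.symm φ φ']
  re_inner_nonneg φ := by
    rcases eq_or_ne φ 0 with rfl | h
    · simp
    · exact (D.pos φ h).le
  add_left φ φ' ψ := by simp
  smul_left φ φ' c := by simp
  definite φ h := by
    by_contra h'
    exact (D.pos φ h').ne' h

/-- The norm on `Q` given by the real part of `Ω`. -/
instance : NormedAddCommGroup D.Q := D.core.toNormedAddCommGroup

/-- The inner product on `Q` given by the real part of `Ω`. -/
instance : InnerProductSpace ℝ D.Q := InnerProductSpace.ofCore D.core.toCore

/-- The quotient map `L → Q`. -/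
def q : L →ₗ[ℝ] D.Q := D.M.mkQ

/-- The quotient map `A → C`. -/
def c (η : A) : D.C := Quotient.mk (quotSetoid D.M A) η

/-- `C` is an affine space over `Q`. -/
instance : AddTorsor D.Q D.C where
  vadd φ ϕ := Quotient.map₂ (sa := Submodule.quotientRel D.M) (sb := quotSetoid D.M A)
    (sc := quotSetoid D.M A) (fun ξ ζ => ξ +ᵥ ζ)
    (fun ξ ξ' h ζ ζ' h' => by
      have h₁ : ξ - ξ' ∈ D.M := (Submodule.quotientRel_def D.M).1 h
      have h₂ : ζ -ᵥ ζ' ∈ D.M := h'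
      change (ξ +ᵥ ζ) -ᵥ (ξ' +ᵥ ζ') ∈ D.M
      rw [vadd_vsub_vadd_comm]
      exact D.M.add_mem h₁ h₂) φ ϕ
  zero_vadd ϕ := by
    induction ϕ using Quotient.inductionOn with
    | _ ζ => exact congrArg D.c (zero_vadd L ζ)
  add_vadd φ φ' ϕ := by
    induction φ using Submodule.Quotient.induction_on with
    | _ ξ =>
      induction φ' using Submodule.Quotient.induction_on with
      | _ ξ' =>
        induction ϕ using Quotient.inductionOn with
        | _ ζ => exact congrArg D.c (add_vadd ξ ξ' ζ)
  vsub ϕ ϕ' := Quotient.liftOn₂ ϕ ϕ' (fun ζ ζ' => D.q (ζ -ᵥ ζ'))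
    (fun ζ₁ ζ₂ ζ₁' ζ₂' h h' => by
      have h₁ : ζ₁ -ᵥ ζ₁' ∈ D.M := h
      have h₂ : ζ₂ -ᵥ ζ₂' ∈ D.M := h'
      refine (Submodule.Quotient.eq D.M).2 ?_
      rw [vsub_sub_vsub_comm]
      exact D.M.sub_mem h₁ h₂)
  nonempty := (AddTorsor.nonempty (G := L) (P := A)).map D.c
  vsub_vadd' ϕ ϕ' := by
    induction ϕ using Quotient.inductionOn with
    | _ ζ =>
      induction ϕ' using Quotient.inductionOn with
      | _ ζ' => exact congrArg D.c (vsub_vadd ζ ζ')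
  vadd_vsub' φ ϕ := by
    induction φ using Submodule.Quotient.induction_on with
    | _ ξ =>
      induction ϕ using Quotient.inductionOn with
      | _ ζ => exact congrArg D.q (vadd_vsub ξ ζ)

/-- The symplectic potential as a map on `A × Q`. -/
def θQ (η : A) : D.Q →ₗ[ℝ] ℝ :=
  D.M.liftQ (D.θ η) fun τ hτ => LinearMap.mem_ker.2 (D.adapted η τ hτ)

/-- The bilinear form `bracket` as a map on `L × Q`. -/
def bracketQ (ξ : L) : D.Q →ₗ[ℝ] ℝ :=
  D.M.liftQ (D.bracket ξ) fun _ hτ => LinearMap.mem_ker.2 (hτ ξ)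

/-- The form `Ω` as a map on `Q × Q`. -/
def ΩQ (φ φ' : D.Q) : ℂ := D.Ω φ φ'

/-- `Ω` is admissible: `Q` is a separable Hilbert space for the real part of `Ω`, the imaginary
part of `Ω` is continuous on it, and the continuous linear functionals on it are exactly the maps
`φ ↦ [ξ, φ]` with `ξ ∈ L`. -/
class Admissible : Prop where
  complete : CompleteSpace D.Q
  separable : TopologicalSpace.SeparableSpace D.Q
  continuous_im : Continuous fun p : D.Q × D.Q => (D.ΩQ p.1 p.2).im
  continuous_bracket : ∀ ξ : L, Continuous (D.bracketQ ξ)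
  exists_bracket : ∀ l : StrongDual ℝ D.Q, ∃ ξ : L, ∀ φ : D.Q, l φ = D.bracketQ ξ φ

instance [D.Admissible] : CompleteSpace D.Q := Admissible.complete

/-- The wave function on `C` of the affine coherent state associated with `ζ ∈ A`. -/
def coherent (ζ : A) (ϕ : D.C) : ℂ :=
  cexp (I * (D.θQ ζ (ϕ -ᵥ D.c ζ) : ℂ) - 1 / 2 * D.ΩQ (ϕ -ᵥ D.c ζ) (ϕ -ᵥ D.c ζ))

/-- The `η`-reduced wave function, a function on `Q`, of a wave function `Ψ` on `C`; it is
characterized by `Ψ ϕ = reduced η Ψ (ϕ - c η) * coherent η ϕ`. -/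
def reduced (η : A) (Ψ : D.C → ℂ) (φ : D.Q) : ℂ :=
  Ψ (φ +ᵥ D.c η) / D.coherent η (φ +ᵥ D.c η)

/-- The quotient of coherent states relating the base points `η` and `η'`. -/
def β (η η' : A) (φ : D.Q) : ℂ :=
  D.coherent η (φ +ᵥ D.c η') / D.coherent η' (φ +ᵥ D.c η')

/-- The change of base point from `η` to `η'` for functions on the extension of `Q`. -/
def rebase (η η' : A) (ψ : Hat D.Q → ℂ) (Φ : Hat D.Q) : ℂ :=
  ψ (Φ + incl D.Q (D.q (η' -ᵥ η))) * cylExtend (D.β η η') Φ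

end SchrodingerData

end SchrodingerRep

end

open SchrodingerRep

/-!
The quotient `β` of coherent states is the exponential of a continuous affine function of `φ`, so it
factors through a finite-dimensional quotient of `Q` and hence extends continuously to `Hat Q`;
the extension is unique because `Q` is dense in `Hat Q`.

With `a = q (η' - η)`, the Gaussian measure of density `exp (-‖φ‖ ^ 2)` is carried by the
translation by `a` to itself once it is multiplied by `exp (-‖a‖ ^ 2 - 2 ⟪a, φ⟫)`, which is
`‖β φ‖ ^ 2`. Translation by `a` followed by multiplication with `β` therefore preserves
inner products. The invariance is a statement about finite-dimensional quotients `Q / W` for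
small `W`, and for `W` orthogonal to `a` it follows by completing the square.
-/

noncomputable section

namespace SchrodingerRep

section Hat

variable {E : Type*} [NormedAddCommGroup E] [InnerProductSpace ℝ E]

theorem Hat.isInducing_eval :
    Topology.IsInducing fun (Φ : Hat E) (l : StrongDual ℝ E) => Φ.eval l := ⟨rfl⟩

theorem Hat.continuous_eval (l : StrongDual ℝ E) : Continuous fun Φ : Hat E => Φ.eval l :=
  (continuous_apply l).comp Hat.isInducing_eval.continuous

instance : MeasurableAdd (Hat E) where
  measurable_const_add Ψ := measurable_hat fun l => (measurable_eval l).const_add (Ψ.eval l)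
  measurable_add_const Ψ := measurable_hat fun l => (measurable_eval l).add_const (Ψ.eval l)

theorem continuous_proj (W : FinCodim E) : Continuous (proj W) := by
  let b := Module.finBasis ℝ W.Quot
  refine b.equivFunL.comp_continuous_iff.1 (continuous_pi fun i => ?_)
  exact (Hat.continuous_eval (pullback W (b.coord i))).congr fun Φ => (apply_proj W Φ _).symm

theorem proj_incl (W : FinCodim E) (x : E) : proj W (incl E x) = W.carrier.mkQ x :=
  (Module.evalEquiv ℝ W.Quot).symm_apply_eq.2 rfl

theorem proj_add_incl (W : FinCodim E) (Φ : Hat E) (a : E) :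
    proj W (Φ + incl E a) = proj W Φ + W.carrier.mkQ a := by
  rw [map_add, proj_incl]

theorem exists_proj_eq (W : FinCodim E) (Φ : Hat E) : ∃ x : E, proj W Φ = W.carrier.mkQ x :=
  (W.carrier.mkQ_surjective (proj W Φ)).imp fun _ => Eq.symm

theorem factor_proj {W W' : FinCodim E} (h : W.carrier ≤ W'.carrier) (Φ : Hat E) :
    Submodule.factor h (proj W Φ) = proj W' Φ := by
  refine Module.eval_apply_injective ℝ (LinearMap.ext fun l => ?_)
  exact (apply_proj W Φ (l ∘ₗ Submodule.factor h)).trans (apply_proj W' Φ l).symm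

theorem proj_eq_mkQ_of_le {W W' : FinCodim E} (h : W.carrier ≤ W'.carrier) {Φ : Hat E} {x : E}
    (hx : proj W Φ = W.carrier.mkQ x) : proj W' Φ = W'.carrier.mkQ x := by
  rw [← factor_proj h, hx]
  rfl

theorem denseRange_incl : DenseRange (incl E) := by
  intro Φ
  rw [Hat.isInducing_eval.closure_eq_preimage_closure_image]
  refine mem_closure_iff.2 fun o ho hΦ => ?_
  obtain ⟨I, u, hu, hIo⟩ := isOpen_pi_iff.1 ho _ hΦ
  obtain ⟨x, hx⟩ := exists_proj_eq (commonKer I) Φ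
  refine ⟨_, hIo fun l hl => ?_, Set.mem_image_of_mem _ ⟨x, rfl⟩⟩
  obtain ⟨l', hl'⟩ := exists_pullback_eq I ⟨l, hl⟩
  have heval : Φ.eval l = l x := by
    rw [← show pullback (commonKer I) l' = l from hl', ← apply_proj, hx]
    rfl
  exact heval ▸ (hu l hl).2

end Hat

namespace FinCodim

variable {E V : Type*} [NormedAddCommGroup E] [InnerProductSpace ℝ E] [NormedAddCommGroup V]
  [NormedSpace ℝ V] [FiniteDimensional ℝ V]

/-- The intersection of two closed subspaces of finite codimension, which provides a common
finite-dimensional quotient for two cylindrical functions. -/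
def inf (W W' : FinCodim E) : FinCodim E where
  carrier := W.carrier ⊓ W'.carrier
  isClosed := W.isClosed.inter W'.isClosed
  finiteDimensional := Submodule.CoFG.inf W.finiteDimensional W'.finiteDimensional

/-- The kernel of a continuous linear map to a finite-dimensional space. -/
def ker (T : E →L[ℝ] V) : FinCodim E where
  carrier := T.toLinearMap.ker
  isClosed := T.isClosed_ker
  finiteDimensional := T.toLinearMap.quotKerEquivRange.symm.finiteDimensional

end FinCodim

section Cylindrical

variable {E : Type*} [NormedAddCommGroup E] [InnerProductSpace ℝ E]

theorem DescendsTo.mono {W W' : FinCodim E} {f : E → ℂ} (hf : DescendsTo W' f)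
    (h : W.carrier ≤ W'.carrier) : DescendsTo W f :=
  fun x w hw => hf x w (h hw)

theorem descendsTo_comp_mkQ (W : FinCodim E) (g : W.Quot → ℂ) :
    DescendsTo W (g ∘ W.carrier.mkQ) := fun x w hw => by
  rw [Function.comp_apply, map_add, W.carrier.mkQ_apply w,
    (Submodule.Quotient.mk_eq_zero _).2 hw, add_zero, Function.comp_apply]

theorem DescendsTo.factorsThrough_mkQ {W : FinCodim E} {f : E → ℂ} (hf : DescendsTo W f) :
    f.FactorsThrough W.carrier.mkQ := fun x y hxy => by
  simpa only [add_sub_cancel] using hf y (x - y) ((Submodule.Quotient.eq _).1 hxy)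

theorem DescendsTo.mul {W : FinCodim E} {f g : E → ℂ} (hf : DescendsTo W f)
    (hg : DescendsTo W g) : DescendsTo W fun x => f x * g x :=
  fun x w hw => congrArg₂ (· * ·) (hf x w hw) (hg x w hw)

theorem DescendsTo.comp_add_right {W : FinCodim E} {f : E → ℂ} (hf : DescendsTo W f) (a : E) :
    DescendsTo W fun x => f (x + a) :=
  fun x w hw => (congrArg f (add_right_comm x w a)).trans (hf (x + a) w hw)

theorem DescendsTo.cylExtend_eq {W : FinCodim E} {f : E → ℂ} (hf : DescendsTo W f) {Φ : Hat E}
    {x : E} (hx : proj W Φ = W.carrier.mkQ x) : cylExtend f Φ = f x := by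
  have hcyl : IsCylindrical f := ⟨W, hf⟩
  obtain ⟨y, hy⟩ := exists_proj_eq (W.inf hcyl.choose) Φ
  have hxy : W.carrier.mkQ x = W.carrier.mkQ y := hx ▸ proj_eq_mkQ_of_le inf_le_left hy
  have hout : hcyl.choose.carrier.mkQ (Quotient.out (proj hcyl.choose Φ)) =
      hcyl.choose.carrier.mkQ y :=
    (Quotient.out_eq _).trans (proj_eq_mkQ_of_le inf_le_right hy)
  rw [cylExtend, dif_pos hcyl, hcyl.choose_spec.factorsThrough_mkQ hout,
    hf.factorsThrough_mkQ hxy]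

theorem cylExtend_comp_mkQ (W : FinCodim E) (g : W.Quot → ℂ) :
    cylExtend (g ∘ W.carrier.mkQ) = g ∘ proj W := by
  funext Φ
  obtain ⟨x, hx⟩ := exists_proj_eq W Φ
  rw [(descendsTo_comp_mkQ W g).cylExtend_eq hx, Function.comp_apply, Function.comp_apply, hx]

namespace IsCylindrical

variable {f g : E → ℂ}

theorem cylExtend_incl (hf : IsCylindrical f) (x : E) : cylExtend f (incl E x) = f x := by
  obtain ⟨W, hW⟩ := hf
  exact hW.cylExtend_eq (proj_incl W x)

theorem exists_continuous_eq_comp_mkQ (hf : IsCylindrical f) (hc : Continuous f) :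
    ∃ (W : FinCodim E) (g : W.Quot → ℂ), Continuous g ∧ f = g ∘ W.carrier.mkQ := by
  obtain ⟨W, hW⟩ := hf
  obtain ⟨g, rfl⟩ := (Function.factorsThrough_iff f).1 hW.factorsThrough_mkQ
  exact ⟨W, g, W.carrier.isQuotientMap_mkQ.continuous_iff.2 hc, rfl⟩

theorem continuous_cylExtend (hf : IsCylindrical f) (hc : Continuous f) :
    Continuous (cylExtend f) := by
  obtain ⟨W, g, hg, rfl⟩ := hf.exists_continuous_eq_comp_mkQ hc
  exact cylExtend_comp_mkQ W g ▸ hg.comp (continuous_proj W)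

theorem measurable_cylExtend (hf : IsCylindrical f) (hc : Continuous f) :
    Measurable (cylExtend f) := by
  obtain ⟨W, g, hg, rfl⟩ := hf.exists_continuous_eq_comp_mkQ hc
  exact cylExtend_comp_mkQ W g ▸ hg.measurable.comp (measurable_proj W)

theorem eq_cylExtend_iff (hf : IsCylindrical f) (hc : Continuous f) {b : Hat E → ℂ} :
    (Continuous b ∧ ∀ x, b (incl E x) = f x) ↔ b = cylExtend f := by
  constructor
  · rintro ⟨hb, hbf⟩
    exact denseRange_incl.equalizer hb (hf.continuous_cylExtend hc)
      (funext fun x => (hbf x).trans (hf.cylExtend_incl x).symm)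
  · rintro rfl
    exact ⟨hf.continuous_cylExtend hc, hf.cylExtend_incl⟩

theorem exists_descendsTo_descendsTo (hf : IsCylindrical f) (hg : IsCylindrical g) :
    ∃ W : FinCodim E, DescendsTo W f ∧ DescendsTo W g := by
  obtain ⟨W, hW⟩ := hf
  obtain ⟨W', hW'⟩ := hg
  exact ⟨W.inf W', hW.mono inf_le_left, hW'.mono inf_le_right⟩

theorem mul (hf : IsCylindrical f) (hg : IsCylindrical g) : IsCylindrical fun x => f x * g x := by
  obtain ⟨W, hWf, hWg⟩ := hf.exists_descendsTo_descendsTo hg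
  exact ⟨W, hWf.mul hWg⟩

theorem cylExtend_mul (hf : IsCylindrical f) (hg : IsCylindrical g) (Φ : Hat E) :
    cylExtend (fun x => f x * g x) Φ = cylExtend f Φ * cylExtend g Φ := by
  obtain ⟨W, hWf, hWg⟩ := hf.exists_descendsTo_descendsTo hg
  obtain ⟨x, hx⟩ := exists_proj_eq W Φ
  rw [(hWf.mul hWg).cylExtend_eq hx, hWf.cylExtend_eq hx, hWg.cylExtend_eq hx]

theorem comp_add_right (hf : IsCylindrical f) (a : E) : IsCylindrical fun x => f (x + a) := by
  obtain ⟨W, hW⟩ := hf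
  exact ⟨W, hW.comp_add_right a⟩

theorem cylExtend_comp_add_right (hf : IsCylindrical f) (a : E) (Φ : Hat E) :
    cylExtend (fun x => f (x + a)) Φ = cylExtend f (Φ + incl E a) := by
  obtain ⟨W, hW⟩ := hf
  obtain ⟨x, hx⟩ := exists_proj_eq W Φ
  have hxa : proj W (Φ + incl E a) = W.carrier.mkQ (x + a) := by rw [proj_add_incl, hx, map_add]
  rw [(hW.comp_add_right a).cylExtend_eq hx, hW.cylExtend_eq hxa]

end IsCylindrical

theorem isCylindrical_comp_continuousLinearMap {V : Type*} [NormedAddCommGroup V]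
    [NormedSpace ℝ V] [FiniteDimensional ℝ V] (g : V → ℂ) (T : E →L[ℝ] V) :
    IsCylindrical fun x => g (T x) :=
  ⟨FinCodim.ker T, fun x w hw => congrArg g (by rw [map_add, show T w = 0 from hw, add_zero])⟩

end Cylindrical

section CameronMartin

theorem map_withDensity_comp {α γ : Type*} {mα : MeasurableSpace α} {mγ : MeasurableSpace γ}
    (μ : Measure α) {f : α → γ} {g : γ → ENNReal} (hf : Measurable f) (hg : Measurable g) :
    (μ.withDensity (g ∘ f)).map f = (μ.map f).withDensity g := by
  refine Measure.ext fun s hs => ?_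
  rw [Measure.map_apply hf hs, withDensity_apply _ (hf hs), withDensity_apply _ hs,
    setLIntegral_map hs hg hf]
  rfl

theorem map_add_right_withDensity_gaussian {V : Type*} [NormedAddCommGroup V]
    [InnerProductSpace ℝ V] [FiniteDimensional ℝ V] [MeasurableSpace V] [BorelSpace V] (a : V) :
    ((gaussian V).withDensity fun v =>
      ENNReal.ofReal (Real.exp (-‖a‖ ^ 2 - 2 * inner ℝ a v))).map (· + a) = gaussian V := by
  let ρ : V → ENNReal := fun v => ENNReal.ofReal (Real.exp (-‖v‖ ^ 2))
  have hρ : Measurable ρ := by fun_prop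
  have hmul : (ρ * fun v => ENNReal.ofReal (Real.exp (-‖a‖ ^ 2 - 2 * inner ℝ a v))) =
      ρ ∘ (· + a) := by
    funext v
    simp only [ρ, Pi.mul_apply, Function.comp_apply]
    rw [← ENNReal.ofReal_mul (Real.exp_pos _).le, ← Real.exp_add, norm_add_sq_real,
      real_inner_comm]
    ring_nf
  rw [gaussian, withDensity_smul_measure, ← withDensity_mul _ hρ (by fun_prop), hmul,
    Measure.map_smul, map_withDensity_comp _ (measurable_add_const a) hρ,
    map_add_right_eq_self]

theorem inner_mkQ_mkQ {E : Type*} [NormedAddCommGroup E] [InnerProductSpace ℝ E]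
    {K : Submodule ℝ E} [IsClosed (K : Set E)] [K.HasOrthogonalProjection] {a : E} (ha : a ∈ Kᗮ)
    (x : E) : inner ℝ (K.mkQ a) (K.mkQ x) = inner ℝ a x := by
  obtain ⟨y, hy, z, hz, rfl⟩ := K.exists_add_mem_mem_orthogonal x
  rw [map_add, K.mkQ_apply y, (Submodule.Quotient.mk_eq_zero K).2 hy, zero_add, inner_add_right,
    Submodule.inner_left_of_mem_orthogonal hy ha, zero_add]
  exact Submodule.Quotient.inner_mk_mk K a z ha hz

theorem norm_mkQ {E : Type*} [NormedAddCommGroup E] [InnerProductSpace ℝ E]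
    {K : Submodule ℝ E} [IsClosed (K : Set E)] [K.HasOrthogonalProjection] {a : E} (ha : a ∈ Kᗮ) :
    ‖K.mkQ a‖ = ‖a‖ := by
  rw [norm_eq_sqrt_real_inner, norm_eq_sqrt_real_inner, inner_mkQ_mkQ ha]

variable {E : Type*} [NormedAddCommGroup E] [InnerProductSpace ℝ E]

/-- The density of the translate of the Gaussian measure by `-a` with respect to the Gaussian
measure itself. -/
def cameronMartinDensity (a : E) (Φ : Hat E) : ℝ :=
  Real.exp (-‖a‖ ^ 2 - 2 * Φ.eval (innerSL ℝ a))

theorem cameronMartinDensity_pos (a : E) (Φ : Hat E) : 0 < cameronMartinDensity a Φ :=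
  Real.exp_pos _

theorem continuous_cameronMartinDensity (a : E) : Continuous (cameronMartinDensity a) :=
  Real.continuous_exp.comp
    (continuous_const.sub (continuous_const.mul (Hat.continuous_eval (innerSL ℝ a))))

theorem measurable_cameronMartinDensity (a : E) : Measurable (cameronMartinDensity a) :=
  Real.measurable_exp.comp (((measurable_eval (innerSL ℝ a)).const_mul 2).const_sub _)

theorem measurable_factor {W W' : FinCodim E} (h : W.carrier ≤ W'.carrier) :
    Measurable (Submodule.factor h : W.Quot → W'.Quot) :=
  (LinearMap.continuous_of_finiteDimensional (Submodule.factor h)).measurable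

variable [CompleteSpace E]

theorem Hat.eval_innerSL_eq_inner_proj {W : FinCodim E} {a : E} (ha : a ∈ W.carrierᗮ)
    (Φ : Hat E) : Φ.eval (innerSL ℝ a) = inner ℝ (W.carrier.mkQ a) (proj W Φ) := by
  have hpull : pullback W (innerₛₗ ℝ (W.carrier.mkQ a)) = innerSL ℝ a :=
    ContinuousLinearMap.ext (inner_mkQ_mkQ ha)
  rw [← hpull, ← apply_proj, innerₛₗ_apply_apply]

theorem isProjectiveGaussian_gaussianHat : IsProjectiveGaussian (gaussianHat E) :=
  (existsUnique_projectiveGaussian E).choose_spec.1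

theorem map_proj_withDensity_gaussianHat {W : FinCodim E} {a : E} (ha : a ∈ W.carrierᗮ) :
    ((gaussianHat E).withDensity fun Φ => ENNReal.ofReal (cameronMartinDensity a Φ)).map
        (proj W) =
      (gaussian W.Quot).withDensity fun v => ENNReal.ofReal
        (Real.exp (-‖W.carrier.mkQ a‖ ^ 2 - 2 * inner ℝ (W.carrier.mkQ a) v)) := by
  rw [← isProjectiveGaussian_gaussianHat W,
    ← map_withDensity_comp _ (measurable_proj W) (by fun_prop)]
  simp only [cameronMartinDensity, Function.comp_def, Hat.eval_innerSL_eq_inner_proj ha,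
    norm_mkQ ha]

theorem map_factor_gaussian {W W' : FinCodim E} (h : W.carrier ≤ W'.carrier) :
    (gaussian W.Quot).map (Submodule.factor h) = gaussian W'.Quot := by
  rw [← isProjectiveGaussian_gaussianHat W, ← isProjectiveGaussian_gaussianHat W',
    Measure.map_map (measurable_factor h) (measurable_proj W)]
  exact congrArg (Measure.map · _) (funext (factor_proj h))

theorem isProjectiveGaussian_of_forall_exists_le {ν : Measure (Hat E)}
    (hν : ∀ W : FinCodim E, ∃ W' : FinCodim E, W'.carrier ≤ W.carrier ∧
      ν.map (proj W') = gaussian W'.Quot) : IsProjectiveGaussian ν := by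
  intro W
  obtain ⟨W', h, hW'⟩ := hν W
  rw [← map_factor_gaussian h, ← hW', Measure.map_map (measurable_factor h) (measurable_proj W')]
  exact congrArg (Measure.map · _) (funext fun Φ => (factor_proj h Φ).symm)

theorem map_add_right_withDensity_gaussianHat (a : E) :
    ((gaussianHat E).withDensity fun Φ => ENNReal.ofReal (cameronMartinDensity a Φ)).map
      (· + incl E a) = gaussianHat E := by
  refine isProjectiveGaussian_unique (isProjectiveGaussian_of_forall_exists_le fun W => ?_)
    isProjectiveGaussian_gaussianHat
  let W' := W.inf (FinCodim.ker (innerSL ℝ a))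
  have ha : a ∈ W'.carrierᗮ := (Submodule.mem_orthogonal' _ _).2 fun _ hx => hx.2
  have hproj : proj W' ∘ (· + incl E a) = (· + W'.carrier.mkQ a) ∘ proj W' :=
    funext fun Φ => proj_add_incl W' Φ a
  refine ⟨W', inf_le_left, ?_⟩
  rw [Measure.map_map (measurable_proj W') (measurable_add_const _), hproj,
    ← Measure.map_map (measurable_add_const _) (measurable_proj W'),
    map_proj_withDensity_gaussianHat ha, map_add_right_withDensity_gaussian]

theorem integral_comp_add_incl (a : E) (f : Hat E → ℂ) :
    ∫ Φ, cameronMartinDensity a Φ • f (Φ + incl E a) ∂(gaussianHat E) =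
      ∫ Φ, f Φ ∂(gaussianHat E) := by
  conv_rhs => rw [← map_add_right_withDensity_gaussianHat a,
    ← MeasurableEquiv.coe_addRight, integral_map_equiv,
    integral_withDensity_eq_integral_toReal_smul
      (measurable_cameronMartinDensity a).ennreal_ofReal (by simp)]
  simp only [ENNReal.toReal_ofReal (cameronMartinDensity_pos a _).le, MeasurableEquiv.coe_addRight]

theorem integrable_comp_add_incl_iff (a : E) {f : Hat E → ℝ} :
    Integrable (fun Φ => cameronMartinDensity a Φ * f (Φ + incl E a)) (gaussianHat E) ↔
      Integrable f (gaussianHat E) := by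
  conv_rhs => rw [← map_add_right_withDensity_gaussianHat a,
    ← MeasurableEquiv.coe_addRight, integrable_map_equiv,
    integrable_withDensity_iff_integrable_smul'
      (measurable_cameronMartinDensity a).ennreal_ofReal (by simp)]
  simp only [ENNReal.toReal_ofReal (cameronMartinDensity_pos a _).le, smul_eq_mul,
    Function.comp_apply, MeasurableEquiv.coe_addRight]

theorem quasiMeasurePreserving_add_incl (a : E) :
    Measure.QuasiMeasurePreserving (· + incl E a) (gaussianHat E) (gaussianHat E) := by
  refine ⟨measurable_add_const _, ?_⟩
  conv_rhs => rw [← map_add_right_withDensity_gaussianHat a]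
  refine Measure.AbsolutelyContinuous.map (withDensity_absolutelyContinuous'
    (measurable_cameronMartinDensity a).ennreal_ofReal.aemeasurable ?_) (measurable_add_const _)
  exact .of_forall fun Φ => (ENNReal.ofReal_pos.2 (cameronMartinDensity_pos a Φ)).ne'

end CameronMartin

section WeightedTranslation

variable {E : Type*} [NormedAddCommGroup E] [InnerProductSpace ℝ E] {a : E} {b : Hat E → ℂ}

/-- Translation by `a` followed by multiplication with the weight `b`. -/
def weightedTranslate (a : E) (b ψ : Hat E → ℂ) (Φ : Hat E) : ℂ := ψ (Φ + incl E a) * b Φ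

/-- A square root of the Cameron–Martin density of `a` up to a phase: such a weight makes the
weighted translation by `a` unitary for the Gaussian measure. -/
structure IsCameronMartinWeight (a : E) (b : Hat E → ℂ) : Prop where
  measurable : Measurable b
  norm_sq_eq : ∀ Φ, ‖b Φ‖ ^ 2 = cameronMartinDensity a Φ

theorem cameronMartinDensity_neg (a : E) (Φ : Hat E) :
    cameronMartinDensity (-a) Φ = (cameronMartinDensity a (Φ + incl E (-a)))⁻¹ := by
  have heval : (Φ + incl E (-a)).eval (innerSL ℝ a) = Φ.eval (innerSL ℝ a) - ‖a‖ ^ 2 := by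
    rw [← real_inner_self_eq_norm_sq, sub_eq_add_neg, ← inner_neg_right]
    rfl
  have hneg : Φ.eval (innerSL ℝ (-a)) = -Φ.eval (innerSL ℝ a) := by rw [map_neg, map_neg]
  rw [cameronMartinDensity, cameronMartinDensity, ← Real.exp_neg, heval, hneg, norm_neg]
  ring_nf

namespace IsCameronMartinWeight

theorem ne_zero (hb : IsCameronMartinWeight a b) (Φ : Hat E) : b Φ ≠ 0 := by
  have hpos := cameronMartinDensity_pos a Φ
  rw [← hb.norm_sq_eq] at hpos
  exact norm_ne_zero_iff.1 (pow_ne_zero_iff two_ne_zero |>.1 hpos.ne')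

theorem inv (hb : IsCameronMartinWeight a b) :
    IsCameronMartinWeight (-a) fun Φ => (b (Φ + incl E (-a)))⁻¹ where
  measurable := (hb.measurable.comp (measurable_add_const _)).inv
  norm_sq_eq Φ := by rw [norm_inv, inv_pow, hb.norm_sq_eq, cameronMartinDensity_neg]

theorem weightedTranslate_inv (hb : IsCameronMartinWeight a b) (ψ : Hat E → ℂ) :
    weightedTranslate (-a) (fun Φ => (b (Φ + incl E (-a)))⁻¹) (weightedTranslate a b ψ) = ψ := by
  funext Φ
  rw [weightedTranslate, weightedTranslate, mul_inv_cancel_right₀ (hb.ne_zero _), map_neg,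
    neg_add_cancel_right]

theorem weightedTranslate_inv_right (hb : IsCameronMartinWeight a b) (ψ : Hat E → ℂ) :
    weightedTranslate a b (weightedTranslate (-a) (fun Φ => (b (Φ + incl E (-a)))⁻¹) ψ) = ψ := by
  funext Φ
  rw [weightedTranslate, weightedTranslate, map_neg, add_neg_cancel_right,
    inv_mul_cancel_right₀ (hb.ne_zero _)]

variable [CompleteSpace E]

theorem memLp_weightedTranslate (hb : IsCameronMartinWeight a b) {ψ : Hat E → ℂ}
    (hψ : MemLp ψ 2 (gaussianHat E)) : MemLp (weightedTranslate a b ψ) 2 (gaussianHat E) := by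
  have hmeas : AEStronglyMeasurable (weightedTranslate a b ψ) (gaussianHat E) :=
    (hψ.1.comp_quasiMeasurePreserving (quasiMeasurePreserving_add_incl a)).mul
      hb.measurable.aestronglyMeasurable
  rw [memLp_two_iff_integrable_sq_norm hψ.1, ← integrable_comp_add_incl_iff a] at hψ
  refine (memLp_two_iff_integrable_sq_norm hmeas).2 (hψ.congr (.of_forall fun Φ => ?_))
  simp only [weightedTranslate, norm_mul, mul_pow, hb.norm_sq_eq, mul_comm]

theorem innerProd_weightedTranslate (hb : IsCameronMartinWeight a b) (χ ψ : Hat E → ℂ) :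
    innerProd (weightedTranslate a b χ) (weightedTranslate a b ψ) = innerProd χ ψ := by
  rw [innerProd, innerProd, ← integral_comp_add_incl a fun Φ => ψ Φ * starRingEnd ℂ (χ Φ)]
  congr 1 with Φ
  rw [weightedTranslate, weightedTranslate, ← hb.norm_sq_eq, Complex.real_smul,
    Complex.ofReal_pow, ← Complex.mul_conj', map_mul]
  ring

/-- Weighted translation as a linear automorphism of the space of square-integrable functions. -/
def weightedTranslateEquiv (hb : IsCameronMartinWeight a b) : SqInt E ≃ₗ[ℂ] SqInt E where
  toFun ψ := ⟨weightedTranslate a b ψ, hb.memLp_weightedTranslate ψ.2⟩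
  invFun ψ := ⟨weightedTranslate (-a) _ ψ, hb.inv.memLp_weightedTranslate ψ.2⟩
  map_add' _ _ := Subtype.ext (funext fun _ => add_mul _ _ _)
  map_smul' _ _ := Subtype.ext (funext fun _ => mul_assoc _ _ _)
  left_inv ψ := Subtype.ext (hb.weightedTranslate_inv ψ)
  right_inv ψ := Subtype.ext (hb.weightedTranslate_inv_right ψ)

end IsCameronMartinWeight

theorem isCameronMartinWeight_cylExtend {f : E → ℂ} (hf : IsCylindrical f) (hc : Continuous f)
    (hnorm : ∀ x, ‖f x‖ ^ 2 = Real.exp (-‖a‖ ^ 2 - 2 * inner ℝ a x)) :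
    IsCameronMartinWeight a (cylExtend f) where
  measurable := hf.measurable_cylExtend hc
  norm_sq_eq := congrFun <| denseRange_incl.equalizer ((hf.continuous_cylExtend hc).norm.pow 2)
    (continuous_cameronMartinDensity a) <| funext fun x => by
      rw [Function.comp_apply, hf.cylExtend_incl, hnorm]
      rfl

end WeightedTranslation

namespace SchrodingerData

variable {A L : Type*} [AddCommGroup L] [Module ℝ L] [AddTorsor L A] (D : SchrodingerData A L)

theorem coherent_vadd_c (ζ : A) (φ : D.Q) :
    D.coherent ζ (φ +ᵥ D.c ζ) = cexp (I * (D.θQ ζ φ : ℂ) - 1 / 2 * D.ΩQ φ φ) := by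
  rw [coherent, vadd_vsub]

theorem coherent_ne_zero (ζ : A) (ϕ : D.C) : D.coherent ζ ϕ ≠ 0 := Complex.exp_ne_zero _

theorem add_q_vsub_vadd_c (η η' : A) (φ : D.Q) :
    (φ + D.q (η' -ᵥ η)) +ᵥ D.c η = φ +ᵥ D.c η' := by
  rw [add_vadd, show D.q (η' -ᵥ η) = D.c η' -ᵥ D.c η from rfl, vsub_vadd]

theorem θQ_eq_add_bracketQ (η η' : A) (φ : D.Q) :
    D.θQ η' φ = D.θQ η φ + D.bracketQ (η' -ᵥ η) φ := by
  obtain ⟨τ, rfl⟩ := D.M.mkQ_surjective φ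
  calc D.θ η' τ = D.θ ((η' -ᵥ η) +ᵥ η) τ := by rw [vsub_vadd]
    _ = D.θ η τ + D.bracket (η' -ᵥ η) τ := D.equivariant η (η' -ᵥ η) τ

theorem ΩQ_add_add (φ a : D.Q) :
    D.ΩQ (φ + a) (φ + a) = D.ΩQ φ φ + 2 * D.ΩQ a φ + D.ΩQ a a := by
  have hexpand : D.ΩQ (φ + a) (φ + a) = (D.ΩQ φ φ + D.ΩQ φ a) + (D.ΩQ a φ + D.ΩQ a a) :=
    (D.Ω.map_add₂ φ a _).trans
      (congrArg₂ (· + ·) ((D.Ω φ).map_add φ a) ((D.Ω a).map_add φ a))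
  rw [hexpand, show D.ΩQ φ a = D.ΩQ a φ from D.symm φ a]
  ring

theorem β_eq (η η' : A) (φ : D.Q) : D.β η η' φ =
    cexp (I * (D.θ η (η' -ᵥ η) : ℂ) - 1 / 2 * D.ΩQ (D.q (η' -ᵥ η)) (D.q (η' -ᵥ η))
      - I * (D.bracketQ (η' -ᵥ η) φ : ℂ) - D.ΩQ (D.q (η' -ᵥ η)) φ) := by
  rw [β, ← add_q_vsub_vadd_c D η η', coherent_vadd_c, add_q_vsub_vadd_c, coherent_vadd_c,
    ← Complex.exp_sub, D.θQ_eq_add_bracketQ η η', map_add, ΩQ_add_add,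
    show D.θQ η (D.q (η' -ᵥ η)) = D.θ η (η' -ᵥ η) from rfl]
  congr 1
  push_cast
  ring

theorem reduced_eq (η η' : A) (Ψ : D.C → ℂ) (φ : D.Q) :
    D.reduced η' Ψ φ = D.reduced η Ψ (φ + D.q (η' -ᵥ η)) * D.β η η' φ := by
  rw [reduced, reduced, β, add_q_vsub_vadd_c, div_mul_div_cancel₀ (D.coherent_ne_zero _ _)]

theorem ΩQ_self_re (φ : D.Q) : (D.ΩQ φ φ).re = ‖φ‖ ^ 2 := real_inner_self_eq_norm_sq φ

theorem norm_β_sq (η η' : A) (φ : D.Q) :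
    ‖D.β η η' φ‖ ^ 2 =
      Real.exp (-‖D.q (η' -ᵥ η)‖ ^ 2 - 2 * inner ℝ (D.q (η' -ᵥ η)) φ) := by
  rw [β_eq, Complex.norm_exp, ← Real.exp_nat_mul, ← ΩQ_self_re,
    show inner ℝ (D.q (η' -ᵥ η)) φ = (D.ΩQ (D.q (η' -ᵥ η)) φ).re from rfl]
  congr 1
  simp only [Nat.cast_ofNat, one_div, sub_re, mul_re, I_re, ofReal_re, zero_mul, I_im, ofReal_im,
    mul_zero, sub_self, inv_re, re_ofNat, normSq_ofNat, div_self_mul_self', inv_im, im_ofNat,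
    neg_zero, zero_div, sub_zero, zero_sub]
  ring

theorem continuous_ΩQ {a : D.Q} (hΩ : Continuous fun φ => (D.ΩQ a φ).im) :
    Continuous (D.ΩQ a) :=
  (Complex.equivRealProdCLM.comp_continuous_iff).1 ((innerSL ℝ a).continuous.prodMk hΩ)

section Continuity

variable {D} {η η' : A} (hbracket : Continuous (D.bracketQ (η' -ᵥ η)))
  (hΩ : Continuous fun φ => (D.ΩQ (D.q (η' -ᵥ η)) φ).im)

include hbracket hΩ

theorem continuous_β : Continuous (D.β η η') := by
  have := D.continuous_ΩQ hΩ
  rw [funext (D.β_eq η η')]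
  fun_prop

theorem isCylindrical_β : IsCylindrical (D.β η η') := by
  let bracketL : StrongDual ℝ D.Q := ⟨D.bracketQ (η' -ᵥ η), hbracket⟩
  let ΩL : D.Q →L[ℝ] ℂ := ⟨D.Ω (D.q (η' -ᵥ η)), D.continuous_ΩQ hΩ⟩
  rw [funext (D.β_eq η η')]
  exact isCylindrical_comp_continuousLinearMap (fun v : ℝ × ℂ => cexp (I * (D.θ η (η' -ᵥ η) : ℂ)
    - 1 / 2 * D.ΩQ (D.q (η' -ᵥ η)) (D.q (η' -ᵥ η)) - I * (v.1 : ℂ) - v.2)) (bracketL.prod ΩL)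

theorem isCameronMartinWeight_cylExtend_β :
    IsCameronMartinWeight (D.q (η' -ᵥ η)) (cylExtend (D.β η η')) :=
  isCameronMartinWeight_cylExtend (isCylindrical_β hbracket hΩ) (continuous_β hbracket hΩ)
    (D.norm_β_sq η η')

theorem isCylindrical_reduced {Ψ : D.C → ℂ} (hΨ : IsCylindrical (D.reduced η Ψ)) :
    IsCylindrical (D.reduced η' Ψ) := by
  rw [funext (D.reduced_eq η η' Ψ)]
  exact (hΨ.comp_add_right _).mul (isCylindrical_β hbracket hΩ)

theorem cylExtend_reduced {Ψ : D.C → ℂ} (hΨ : IsCylindrical (D.reduced η Ψ)) :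
    cylExtend (D.reduced η' Ψ) = D.rebase η η' (cylExtend (D.reduced η Ψ)) := by
  funext Φ
  rw [funext (D.reduced_eq η η' Ψ),
    (hΨ.comp_add_right _).cylExtend_mul (isCylindrical_β hbracket hΩ),
    hΨ.cylExtend_comp_add_right, rebase]

end Continuity

end SchrodingerData

end SchrodingerRep

end

theorem mainTheorem10_general {A L : Type*} [AddCommGroup L] [Module ℝ L] [AddTorsor L A]
    (D : SchrodingerData A L) [CompleteSpace D.Q] (η η' : A)
    (hbracket : Continuous (D.bracketQ (η' -ᵥ η)))
    (hΩ : Continuous fun φ => (D.ΩQ (D.q (η' -ᵥ η)) φ).im) :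
    (∀ φ : D.Q, D.β η η' φ =
      Complex.exp (Complex.I * (D.θ η (η' -ᵥ η) : ℂ)
        - 1 / 2 * D.ΩQ (D.q (η' -ᵥ η)) (D.q (η' -ᵥ η))
        - Complex.I * (D.bracketQ (η' -ᵥ η) φ : ℂ) - D.ΩQ (D.q (η' -ᵥ η)) φ)) ∧
    Continuous (D.β η η') ∧
    IsCylindrical (D.β η η') ∧
    (∀ W : FinCodim D.Q, DescendsTo W (D.β η η') → ∀ (Φ : Hat D.Q) (φ : D.Q),
      proj W Φ = W.carrier.mkQ φ → cylExtend (D.β η η') Φ = D.β η η' φ) ∧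
    (∀ b : Hat D.Q → ℂ,
      (Continuous b ∧ ∀ φ : D.Q, b (incl D.Q φ) = D.β η η' φ) ↔ b = cylExtend (D.β η η')) ∧
    (∀ (Ψ : D.C → ℂ) (φ : D.Q),
      D.reduced η' Ψ φ = D.reduced η Ψ (φ + D.q (η' -ᵥ η)) * D.β η η' φ) ∧
    (∀ Ψ : D.C → ℂ, IsCylindrical (D.reduced η Ψ) →
      IsCylindrical (D.reduced η' Ψ) ∧
        cylExtend (D.reduced η' Ψ) = D.rebase η η' (cylExtend (D.reduced η Ψ))) ∧
    (∀ ψ : Hat D.Q → ℂ, ψ ∈ SqInt D.Q → D.rebase η η' ψ ∈ SqInt D.Q) ∧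
    ∃ T : SqInt D.Q ≃ₗ[ℂ] SqInt D.Q,
      (∀ ψ : SqInt D.Q, (T ψ : Hat D.Q → ℂ) = D.rebase η η' ψ) ∧
      ∀ χ ψ : SqInt D.Q,
        innerProd (T χ : Hat D.Q → ℂ) (T ψ) = innerProd (χ : Hat D.Q → ℂ) ψ := by
  have hcyl := SchrodingerData.isCylindrical_β hbracket hΩ
  have hcont := SchrodingerData.continuous_β hbracket hΩ
  have hweight := SchrodingerData.isCameronMartinWeight_cylExtend_β hbracket hΩ
  exact ⟨D.β_eq η η', hcont, hcyl, fun _ hW _ _ => hW.cylExtend_eq,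
    fun _ => hcyl.eq_cylExtend_iff hcont, D.reduced_eq η η',
    fun _ hΨ => ⟨SchrodingerData.isCylindrical_reduced hbracket hΩ hΨ,
      SchrodingerData.cylExtend_reduced hbracket hΩ hΨ⟩,
    fun _ => hweight.memLp_weightedTranslate,
    hweight.weightedTranslateEquiv, fun _ => rfl,
    fun χ ψ => hweight.innerProd_weightedTranslate χ ψ⟩

theorem mainTheorem10 {A L : Type*} [AddCommGroup L] [Module ℝ L] [AddTorsor L A]
    (D : SchrodingerData A L) [D.Admissible] (η η' : A) :
    -- the explicit form of the quotient of coherent states, which is continuous and almost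
    -- translation invariant
    (∀ φ : D.Q, D.β η η' φ =
      Complex.exp (Complex.I * (D.θ η (η' -ᵥ η) : ℂ)
        - 1 / 2 * D.ΩQ (D.q (η' -ᵥ η)) (D.q (η' -ᵥ η))
        - Complex.I * (D.bracketQ (η' -ᵥ η) φ : ℂ) - D.ΩQ (D.q (η' -ᵥ η)) φ)) ∧
    Continuous (D.β η η') ∧
    IsCylindrical (D.β η η') ∧
    -- it is well defined on the extension of `Q`: its canonical extension does not depend on the
    -- finite-dimensional quotient used, and is its unique continuous extension
    (∀ W : FinCodim D.Q, DescendsTo W (D.β η η') → ∀ (Φ : Hat D.Q) (φ : D.Q),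
      proj W Φ = W.carrier.mkQ φ → cylExtend (D.β η η') Φ = D.β η η' φ) ∧
    (∀ b : Hat D.Q → ℂ,
      (Continuous b ∧ ∀ φ : D.Q, b (incl D.Q φ) = D.β η η' φ) ↔ b = cylExtend (D.β η η')) ∧
    -- the change of base point sends `η`-reduced to `η'`-reduced wave functions
    (∀ (Ψ : D.C → ℂ) (φ : D.Q),
      D.reduced η' Ψ φ = D.reduced η Ψ (φ + D.q (η' -ᵥ η)) * D.β η η' φ) ∧
    (∀ Ψ : D.C → ℂ, IsCylindrical (D.reduced η Ψ) →
      IsCylindrical (D.reduced η' Ψ) ∧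
        cylExtend (D.reduced η' Ψ) = D.rebase η η' (cylExtend (D.reduced η Ψ))) ∧
    -- it preserves square-integrability
    (∀ ψ : Hat D.Q → ℂ, ψ ∈ SqInt D.Q → D.rebase η η' ψ ∈ SqInt D.Q) ∧
    -- and is an isometric isomorphism of the space of square-integrable functions
    ∃ T : SqInt D.Q ≃ₗ[ℂ] SqInt D.Q,
      (∀ ψ : SqInt D.Q, (T ψ : Hat D.Q → ℂ) = D.rebase η η' ψ) ∧
      ∀ χ ψ : SqInt D.Q, innerProd (T χ : Hat D.Q → ℂ) (T ψ) = innerProd (χ : Hat D.Q → ℂ) ψ := by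
  exact mainTheorem10_general D η η' (SchrodingerData.Admissible.continuous_bracket _)
    (SchrodingerData.Admissible.continuous_im.comp (Continuous.prodMk_right _))
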